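/- Let $\beta\in(0,1)$ and let $p=p(N)\in(0,1]$, $N\ge 1$, satisfy $p(N)^3N^2\to\infty$ as $N\to\infty$. For each $N$ let $(\varepsilon_{i,j})_{i,j=1}^N$ be the edge indicators of a directed Erdős–Rényi random graph with loops on $\{1,\dots,N\}$, i.e. independent random variables with $\mathbb P[\varepsilon_{i,j}=1]=p$ and $\mathbb P[\varepsilon_{i,j}=0]=1-p$ for all ordered pairs $(i,j)$, $i=j$ included. For $\sigma=(\sigma_1,\dots,\sigma_N)\in\{-1,+1\}^N$ put $$H(\sigma)=-\frac{1}{2Np}\sum_{i,j=1}^N\varepsilon_{i,j}\sigma_i\sigma_j,\qquad |\sigma|=\sum_{i=1}^N\sigma_i .$$ For a bounded continuous function $g:\mathbb R\to\mathbb R$ define the generalized partition function $$Z_N(\beta,g)=\sum_{\sigma\in\{-1,+1\}^N}e^{-\beta H(\sigma)}\,g\!\left(\frac{|\sigma|}{\sqrt N}\right).$$ Then, for every bounded continuous $g:\mathbb R\to\mathbb R$ with $g\ge 0$ and $g\not\equiv 0$, the random variable $Z_N(\beta,g)$ is square integrable for every $N\ge 1$, $\mathbb E Z_N(\beta,g)>0$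 for all sufficiently large $N$, and $$\frac{Z_N(\beta,g)}{\mathbb E Z_N(\beta,g)}\longrightarrow 1\qquad (N\to\infty)$$ in $L^2$ and hence in probability, where $\mathbb E$ is the expectation with respect to the randomness of $(\varepsilon_{i,j})_{i,j=1}^N$. -/

import Mathlib

open MeasureTheory ProbabilityTheory Filter Topology
open scoped BoundedContinuousFunction

namespace DiluteIsing

/-- `G` is a random directed Erdős–Rényi graph with loops on the vertex set `Fin N`, defined on the
probability space `(Ω, P)`: for each ordered pair `(i, j)` (with `i = j` allowed) the directed edge
from `i` to `j` is present with probability `q`, independently of all other edges. -/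
structure IsDirectedErdosRenyi {Ω : Type*} [MeasurableSpace Ω] (P : Measure Ω) {N : ℕ} (q : ℝ)
    (G : Ω → Digraph (Fin N)) : Prop where
  measurableSet_edge : ∀ i j, MeasurableSet {ω | (G ω).Adj i j}
  prob_edge : ∀ i j, P.real {ω | (G ω).Adj i j} = q
  indep_edges : iIndepSet (fun e : Fin N × Fin N => {ω | (G ω).Adj e.1 e.2}) P

open Classical in
/-- The indicator `ε i j` of the presence of the directed edge from `i` to `j`. -/
noncomputable def edgeIndicator {N : ℕ} (G : Digraph (Fin N)) (i j : Fin N) : ℝ :=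
  if G.Adj i j then 1 else 0

/-- Spin configurations, the elements of `{-1, +1}^N` (the group `ℤˣ` is `{-1, +1}`). -/
abbrev SpinConfig (N : ℕ) : Type := Fin N → ℤˣ

/-- The spin `σ i` as a real number. -/
def spin {N : ℕ} (σ : SpinConfig N) (i : Fin N) : ℝ := ((σ i : ℤ) : ℝ)

/-- The total magnetization `|σ| = ∑ i, σ i`. -/
def magnetization {N : ℕ} (σ : SpinConfig N) : ℝ := ∑ i, spin σ i

/-- The Hamiltonian `H(σ) = -(1 / (2 N q)) ∑ i j, ε i j * σ i * σ j` of the Ising model on `G`. -/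
noncomputable def hamiltonian {N : ℕ} (q : ℝ) (G : Digraph (Fin N)) (σ : SpinConfig N) : ℝ :=
  -(1 / (2 * (N : ℝ) * q)) * ∑ i, ∑ j, edgeIndicator G i j * spin σ i * spin σ j

/-- The generalized partition function `Z_N(β, g) = ∑ σ, exp (-β H(σ)) * g (|σ| / √N)`. -/
noncomputable def partitionFunction {N : ℕ} (q : ℝ) (G : Digraph (Fin N)) (β : ℝ) (g : ℝ → ℝ) : ℝ :=
  ∑ σ : SpinConfig N,
    Real.exp (-β * hamiltonian q G σ) * g (magnetization σ / Real.sqrt (N : ℝ))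

end DiluteIsing

/-! The proof is a second moment computation. Put γ = β/(2Np) and m(σ) = |σ|/√N. Independence
factorises the moments of exp(-βH) over edges, and since σ_i σ_j = ±1, the logarithm of each factor
is affine in σ_i σ_j, with the even and odd parts of the Bernoulli cumulant generating function at γ
as coefficients. Hence E Z is 2^N exp(N² even(γ)) times a Curie–Weiss average D of exp(N odd(γ) m²)
g(m). For two replicas the same device gives the prefactor 4^N exp(N² even(2γ)/2) and a double
average E with tilt N odd(2γ)/2 in each replica and a coupling N even(2γ)/2 · m(στ)².

Both tilts tend to β/2, and the coupling vanishes because Np → ∞. The quadratic terms of the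
prefactors cancel in E Z² / (E Z)², leaving an exponent at most 8N²pγ⁴ = β⁴/(2p³N²); this is where
p³N² → ∞ is needed (`tendsto_sq_mul_coupling_pow_four`).

Since β/2 < 1/2, exponential moments of m² slightly beyond the tilt are bounded uniformly in N
(`spinAvg_exp_mul_sq_le`), so E - D² → 0 (`tendsto_spinAvg_tilt_sub`). The central limit theorem
keeps D away from 0, so the variance of Z / E Z tends to 0. -/

namespace DiluteIsing

/-! ### Bernoulli cumulant generating function: parity and small-argument bounds -/

section LogMgf

/-- The cumulant generating function `x ↦ log (1 + q (eˣ - 1))` of a Bernoulli(`q`) variable. -/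
noncomputable def bernoulliCgf (q x : ℝ) : ℝ := Real.log (1 + q * (Real.exp x - 1))

variable {q : ℝ}

lemma bernoulliMgf_pos (h0 : 0 < q) (h1 : q ≤ 1) (x : ℝ) : 0 < 1 + q * (Real.exp x - 1) := by
  nlinarith [mul_pos h0 (Real.exp_pos x)]

lemma exp_bernoulliCgf (h0 : 0 < q) (h1 : q ≤ 1) (x : ℝ) :
    Real.exp (bernoulliCgf q x) = 1 + q * (Real.exp x - 1) :=
  Real.exp_log (bernoulliMgf_pos h0 h1 x)

lemma bernoulliCgf_zero (q : ℝ) : bernoulliCgf q 0 = 0 := by simp [bernoulliCgf]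

lemma bernoulliCgf_mono (h0 : 0 < q) (h1 : q ≤ 1) : Monotone (bernoulliCgf q) := by
  intro x y hxy
  refine Real.log_le_log (bernoulliMgf_pos h0 h1 x) ?_
  gcongr

/-- With u = eˣ - 1, replacing u by x costs q x², and qu - 2(qu)² ≤ log(1 + qu) ≤ qu with |u| ≤ 2|x|
costs at most 8q x²; hence the 9. The range of x ensures u ≥ -1/2, which the lower logarithmic bound
needs. -/
lemma abs_bernoulliCgf_sub_le (h0 : 0 < q) (h1 : q ≤ 1) {x : ℝ} (hx : |x| ≤ 1 / 4) :
    |bernoulliCgf q x - q * x| ≤ 9 * q * x ^ 2 := by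
  have he := abs_le.1 (Real.abs_exp_sub_one_sub_id_le (x := x) (by linarith))
  have hpos := bernoulliMgf_pos h0 h1 x
  have hx' := abs_le.1 hx
  set u := Real.exp x - 1 with hu
  have hux : |u| ≤ 2 * |x| := by
    have := Real.abs_exp_sub_one_sub_id_le (x := x) (by linarith)
    have h3 : |u| ≤ |u - x| + |x| := by simpa using abs_add_le (u - x) x
    nlinarith [abs_nonneg x, sq_abs x]
  have hu2 : u ^ 2 ≤ 4 * x ^ 2 := by
    have := mul_self_le_mul_self (abs_nonneg u) hux
    nlinarith [sq_abs u, sq_abs x]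
  have hq2 : q ^ 2 ≤ q := by nlinarith
  have hul : -(1 / 2) ≤ u := by linarith [neg_abs_le u]
  have hlog_le : bernoulliCgf q x ≤ q * u := by
    have := Real.log_le_sub_one_of_pos hpos
    unfold bernoulliCgf; linarith
  have hlog_ge : q * u - 2 * (q * u) ^ 2 ≤ bernoulliCgf q x := by
    have h4 := Real.one_sub_inv_le_log_of_pos hpos
    have h5 : q * u - 2 * (q * u) ^ 2 ≤ 1 - (1 + q * u)⁻¹ := by
      have : 1 - (1 + q * u)⁻¹ - (q * u - 2 * (q * u) ^ 2)
          = (q * u) ^ 2 * (1 + 2 * (q * u)) / (1 + q * u) := by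
        field_simp; ring
      have h6 : 0 ≤ (q * u) ^ 2 * (1 + 2 * (q * u)) / (1 + q * u) := by
        apply div_nonneg (mul_nonneg (sq_nonneg _) _) hpos.le
        nlinarith
      linarith
    exact h5.trans h4
  have hqu : (q * u) ^ 2 ≤ 4 * q * x ^ 2 := by
    rw [mul_pow]
    calc q ^ 2 * u ^ 2 ≤ q * (4 * x ^ 2) := by gcongr
      _ = _ := by ring
  rw [abs_le]
  constructor <;> nlinarith [mul_le_mul_of_nonneg_left he.1 h0.le, mul_le_mul_of_nonneg_left he.2 h0.le]

/-- Even part of the cumulant generating function. -/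
noncomputable def cgfEven (q x : ℝ) : ℝ := (bernoulliCgf q x + bernoulliCgf q (-x)) / 2

/-- Odd part of the cumulant generating function. -/
noncomputable def cgfOdd (q x : ℝ) : ℝ := (bernoulliCgf q x - bernoulliCgf q (-x)) / 2

lemma cgfOdd_nonneg (h0 : 0 < q) (h1 : q ≤ 1) {x : ℝ} (hx : 0 ≤ x) : 0 ≤ cgfOdd q x := by
  have := bernoulliCgf_mono h0 h1 (show -x ≤ x by linarith)
  unfold cgfOdd; linarith

lemma abs_cgfOdd_sub_le (h0 : 0 < q) (h1 : q ≤ 1) {x : ℝ} (hx : |x| ≤ 1 / 4) :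
    |cgfOdd q x - q * x| ≤ 9 * q * x ^ 2 := by
  have h2 := abs_le.1 (abs_bernoulliCgf_sub_le h0 h1 hx)
  have h3 := abs_le.1 (abs_bernoulliCgf_sub_le h0 h1 (x := -x) (by simpa using hx))
  unfold cgfOdd
  rw [abs_le]; constructor <;> linarith [neg_sq x, h2.1, h2.2, h3.1, h3.2]

lemma cgfEven_eq_log (h0 : 0 < q) (h1 : q ≤ 1) (x : ℝ) :
    cgfEven q x = Real.log (1 + q * (1 - q) * (Real.exp x + Real.exp (-x) - 2)) / 2 := by
  unfold cgfEven bernoulliCgf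
  rw [← Real.log_mul (bernoulliMgf_pos h0 h1 x).ne' (bernoulliMgf_pos h0 h1 (-x)).ne']
  congr 2
  have : Real.exp x * Real.exp (-x) = 1 := by rw [← Real.exp_add]; simp
  linear_combination (q ^ 2) * this

lemma exp_add_exp_neg_sub_two_nonneg (x : ℝ) : 0 ≤ Real.exp x + Real.exp (-x) - 2 := by
  linarith [Real.add_one_le_exp x, Real.add_one_le_exp (-x)]

lemma exp_add_exp_neg_sub_two_le {x : ℝ} (hx : |x| ≤ 1) :
    Real.exp x + Real.exp (-x) - 2 ≤ 2 * x ^ 2 := by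
  have h2 := (abs_le.1 (Real.abs_exp_sub_one_sub_id_le hx)).2
  have h3 := (abs_le.1 (Real.abs_exp_sub_one_sub_id_le (x := -x) (by simpa using hx))).2
  linarith [neg_sq x]

lemma cgfEven_nonneg (h0 : 0 < q) (h1 : q ≤ 1) (x : ℝ) : 0 ≤ cgfEven q x := by
  rw [cgfEven_eq_log h0 h1]
  refine div_nonneg (Real.log_nonneg ?_) two_pos.le
  nlinarith [mul_nonneg (mul_nonneg h0.le (sub_nonneg.2 h1)) (exp_add_exp_neg_sub_two_nonneg x)]

lemma exp_two_mul_add_exp_neg_two_mul (x : ℝ) :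
    Real.exp (2 * x) + Real.exp (-(2 * x)) - 2 = (Real.exp x + Real.exp (-x) - 2) ^ 2
      + 4 * (Real.exp x + Real.exp (-x) - 2) := by
  have : Real.exp x * Real.exp (-x) = 1 := by rw [← Real.exp_add]; simp
  rw [show -(2 * x) = -x + -x by ring, two_mul, Real.exp_add, Real.exp_add]
  linear_combination (-2) * this

lemma cgfEven_two_mul_le (h0 : 0 < q) (h1 : q ≤ 1) (x : ℝ) :
    cgfEven q (2 * x) / 2 ≤ q * (1 - q) * ((Real.exp x + Real.exp (-x) - 2) ^ 2 / 4
      + (Real.exp x + Real.exp (-x) - 2)) := by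
  rw [cgfEven_eq_log h0 h1, exp_two_mul_add_exp_neg_two_mul]
  have hT := exp_add_exp_neg_sub_two_nonneg x
  set T := Real.exp x + Real.exp (-x) - 2
  have hQ : 0 ≤ q * (1 - q) := mul_nonneg h0.le (sub_nonneg.2 h1)
  have := Real.log_le_sub_one_of_pos (show 0 < 1 + q * (1 - q) * (T ^ 2 + 4 * T) by positivity)
  nlinarith

lemma cgfEven_two_mul_le_sq (h0 : 0 < q) (h1 : q ≤ 1) {x : ℝ} (hx : |x| ≤ 1) :
    cgfEven q (2 * x) / 2 ≤ 3 * q * x ^ 2 := by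
  refine (cgfEven_two_mul_le h0 h1 x).trans ?_
  have hT := exp_add_exp_neg_sub_two_nonneg x
  have hT' := exp_add_exp_neg_sub_two_le hx
  set T := Real.exp x + Real.exp (-x) - 2
  have hx2 : x ^ 2 ≤ 1 := by rw [← sq_abs]; exact pow_le_one₀ (abs_nonneg x) hx
  have h2 : q * (1 - q) ≤ q := by nlinarith
  have h3 : T ^ 2 / 4 + T ≤ 3 * x ^ 2 := by nlinarith
  calc q * (1 - q) * (T ^ 2 / 4 + T) ≤ q * (3 * x ^ 2) := by gcongr
    _ = _ := by ring

/-- With T = eˣ + e⁻ˣ - 2 and Q = q(1 - q), the doubling identity bounds the first term by Q(T²/4 +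
T), while the second is log(1 + QT) ≥ QT - (QT)². The terms QT cancel and only T² = O(x⁴) survives,
with a single factor q. -/
lemma cgfEven_two_mul_sub_le (h0 : 0 < q) (h1 : q ≤ 1) {x : ℝ} (hx : |x| ≤ 1) :
    cgfEven q (2 * x) / 2 - 2 * cgfEven q x ≤ 8 * q * x ^ 4 := by
  have h2 := cgfEven_two_mul_le h0 h1 x
  rw [cgfEven_eq_log h0 h1 x]
  have hT := exp_add_exp_neg_sub_two_nonneg x
  have hT' := exp_add_exp_neg_sub_two_le hx
  set T := Real.exp x + Real.exp (-x) - 2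
  have hQ : 0 ≤ q * (1 - q) := mul_nonneg h0.le (sub_nonneg.2 h1)
  have hQq : q * (1 - q) ≤ q := by nlinarith
  set Q := q * (1 - q)
  have hpos : 0 < 1 + Q * T := by positivity
  have h4 := Real.one_sub_inv_le_log_of_pos hpos
  have h5 : Q * T - (Q * T) ^ 2 ≤ 1 - (1 + Q * T)⁻¹ := by
    have : 1 - (1 + Q * T)⁻¹ - (Q * T - (Q * T) ^ 2) = (Q * T) ^ 3 / (1 + Q * T) := by
      field_simp; ring
    have h6 : 0 ≤ (Q * T) ^ 3 / (1 + Q * T) := by positivity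
    linarith
  have hT2 : T ^ 2 ≤ 4 * x ^ 4 := by nlinarith [sq_nonneg x]
  have hQ2 : Q ^ 2 ≤ q := by nlinarith
  have h6 : Q * T ^ 2 ≤ q * (4 * x ^ 4) := by gcongr
  have h7 : Q ^ 2 * T ^ 2 ≤ q * (4 * x ^ 4) := by gcongr
  have h8 : 0 ≤ q * x ^ 4 := by positivity
  nlinarith

end LogMgf

/-! ### Edge-factorised exponential moments -/

section Moments

lemma spin_eq {N : ℕ} (σ : SpinConfig N) (i : Fin N) : spin σ i = 1 ∨ spin σ i = -1 := by
  rcases Int.units_eq_one_or (σ i) with h | h <;> simp [spin, h]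

lemma spin_mul {N : ℕ} (σ τ : SpinConfig N) (i : Fin N) :
    spin (σ * τ) i = spin σ i * spin τ i := by simp [spin]

lemma sum_sum_spin_mul_spin {N : ℕ} (σ : SpinConfig N) :
    ∑ i, ∑ j, spin σ i * spin σ j = magnetization σ ^ 2 := by
  simp_rw [sq, magnetization, Finset.sum_mul_sum]

variable {Ω : Type*} {N : ℕ} {q : ℝ}

lemma edgeIndicator_eq_indicator (G : Ω → Digraph (Fin N)) (i j : Fin N) :
    (fun ω => edgeIndicator (G ω) i j) = Set.indicator {ω | (G ω).Adj i j} 1 := by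
  classical
  ext ω; simp [edgeIndicator, Set.indicator_apply]

lemma neg_mul_hamiltonian (β : ℝ) (G : Digraph (Fin N)) (σ : SpinConfig N) :
    -β * hamiltonian q G σ = ∑ i, ∑ j,
      (β / (2 * N * q) * (spin σ i * spin σ j)) * edgeIndicator G i j := by
  simp_rw [hamiltonian, ← mul_assoc, Finset.mul_sum]
  refine Finset.sum_congr rfl fun i _ => Finset.sum_congr rfl fun j _ => ?_
  ring

variable [MeasurableSpace Ω] {P : Measure Ω} {G : Ω → Digraph (Fin N)}

lemma IsDirectedErdosRenyi.measurable_edgeIndicator (hG : IsDirectedErdosRenyi P q G)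
    (i j : Fin N) : Measurable fun ω => edgeIndicator (G ω) i j := by
  rw [edgeIndicator_eq_indicator]
  exact measurable_one.indicator (hG.measurableSet_edge i j)

variable [IsProbabilityMeasure P]

lemma IsDirectedErdosRenyi.integral_exp_mul_edgeIndicator (hG : IsDirectedErdosRenyi P q G)
    (i j : Fin N) (x : ℝ) :
    ∫ ω, Real.exp (x * edgeIndicator (G ω) i j) ∂P = 1 + q * (Real.exp x - 1) := by
  have h (ω : Ω) : Real.exp (x * edgeIndicator (G ω) i j)
      = 1 + Set.indicator {ω | (G ω).Adj i j} (fun _ => Real.exp x - 1) ω := by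
    by_cases h : (G ω).Adj i j <;> simp [edgeIndicator, h]
  simp_rw [h]
  rw [integral_add (integrable_const _) ((integrable_const _).indicator (hG.measurableSet_edge i j)),
    integral_indicator_const _ (hG.measurableSet_edge i j), hG.prob_edge]
  simp

lemma IsDirectedErdosRenyi.integral_exp_sum (hG : IsDirectedErdosRenyi P q G)
    (c : Fin N → Fin N → ℝ) :
    ∫ ω, Real.exp (∑ i, ∑ j, c i j * edgeIndicator (G ω) i j) ∂P
      = ∏ i, ∏ j, (1 + q * (Real.exp (c i j) - 1)) := by
  have hi : iIndepFun (fun (e : Fin N × Fin N) ω => edgeIndicator (G ω) e.1 e.2) P := by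
    have := hG.indep_edges.iIndepFun_indicator (β := ℝ) (m := inferInstance)
    convert this using 2 with e
    exact edgeIndicator_eq_indicator G e.1 e.2
  have h := hi.integral_fun_prod_comp (f := fun e x => Real.exp (c e.1 e.2 * x))
    (fun e => (hG.measurable_edgeIndicator e.1 e.2).aemeasurable)
    (fun e => by fun_prop)
  simp_rw [← Finset.sum_product', ← Finset.prod_product', Finset.univ_product_univ, Real.exp_sum]
  rw [h]
  exact Finset.prod_congr rfl fun e _ => hG.integral_exp_mul_edgeIndicator e.1 e.2 _

lemma IsDirectedErdosRenyi.integral_exp_hamiltonian (hG : IsDirectedErdosRenyi P q G)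
    (h0 : 0 < q) (h1 : q ≤ 1) (β : ℝ) (σ : SpinConfig N) :
    ∫ ω, Real.exp (-β * hamiltonian q (G ω) σ) ∂P
      = Real.exp (N ^ 2 * cgfEven q (β / (2 * N * q))
          + cgfOdd q (β / (2 * N * q)) * magnetization σ ^ 2) := by
  simp_rw [neg_mul_hamiltonian]
  rw [hG.integral_exp_sum]
  set γ := β / (2 * N * q)
  have h (i j : Fin N) : 1 + q * (Real.exp (γ * (spin σ i * spin σ j)) - 1)
      = Real.exp (cgfEven q γ + cgfOdd q γ * (spin σ i * spin σ j)) := by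
    rw [← exp_bernoulliCgf h0 h1]
    congr 1
    rcases spin_eq σ i with hi | hi <;> rcases spin_eq σ j with hj | hj <;>
      simp [hi, hj, cgfEven, cgfOdd] <;> ring
  simp_rw [h, ← Real.exp_sum, Finset.sum_add_distrib, ← Finset.mul_sum]
  rw [← sum_sum_spin_mul_spin]
  simp [Finset.mul_sum]
  ring

/-- For signs s, t the sum s + t lies in {-2, 0, 2} and the generating function vanishes at 0, so
its value at γ(s + t) is even(2γ)/2 · (1 + st) + odd(2γ)/2 · (s + t). The product st belongs to the
configuration `σ * τ`. -/
lemma IsDirectedErdosRenyi.integral_exp_hamiltonian_mul (hG : IsDirectedErdosRenyi P q G)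
    (h0 : 0 < q) (h1 : q ≤ 1) (β : ℝ) (σ τ : SpinConfig N) :
    ∫ ω, Real.exp (-β * hamiltonian q (G ω) σ) * Real.exp (-β * hamiltonian q (G ω) τ) ∂P
      = Real.exp (N ^ 2 * (cgfEven q (2 * (β / (2 * N * q))) / 2)
          + cgfEven q (2 * (β / (2 * N * q))) / 2 * magnetization (σ * τ) ^ 2
          + cgfOdd q (2 * (β / (2 * N * q))) / 2
            * (magnetization σ ^ 2 + magnetization τ ^ 2)) := by
  simp_rw [← Real.exp_add, neg_mul_hamiltonian, ← Finset.sum_add_distrib, ← add_mul, ← mul_add]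
  rw [hG.integral_exp_sum]
  set γ := β / (2 * N * q)
  have h (i j : Fin N) : 1 + q * (Real.exp (γ * (spin σ i * spin σ j + spin τ i * spin τ j)) - 1)
      = Real.exp (cgfEven q (2 * γ) / 2 + cgfEven q (2 * γ) / 2 * (spin (σ * τ) i * spin (σ * τ) j)
        + cgfOdd q (2 * γ) / 2 * (spin σ i * spin σ j + spin τ i * spin τ j)) := by
    rw [← exp_bernoulliCgf h0 h1, spin_mul, spin_mul]
    congr 1
    have e1 : γ * (1 + 1) = 2 * γ := by ring
    have e2 : γ * (-1 + -1) = -(2 * γ) := by ring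
    rcases spin_eq σ i with hi | hi <;> rcases spin_eq σ j with hj | hj <;>
    rcases spin_eq τ i with hi' | hi' <;> rcases spin_eq τ j with hj' | hj' <;>
      simp [hi, hj, hi', hj', cgfEven, cgfOdd, e1, e2, bernoulliCgf_zero] <;> ring
  simp_rw [h, ← Real.exp_sum, Finset.sum_add_distrib, ← Finset.mul_sum, Finset.sum_add_distrib]
  rw [← sum_sum_spin_mul_spin, ← sum_sum_spin_mul_spin, ← sum_sum_spin_mul_spin]
  simp [Finset.mul_sum]
  ring

end Moments

/-! ### Uniform spin averages and Gaussian domination -/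

section SpinSums

/-- The average of `f` over all spin configurations. -/
noncomputable def spinAvg (N : ℕ) (f : SpinConfig N → ℝ) : ℝ := (∑ σ, f σ) / 2 ^ N

lemma sum_prod_units {R : Type*} [CommSemiring R] (N : ℕ) (f : ℤˣ → R) :
    ∑ σ : SpinConfig N, ∏ i, f (σ i) = (f 1 + f (-1)) ^ N := by
  rw [← Fintype.sum_pow, UnitsInt.univ, Finset.sum_pair (by decide)]

lemma spinAvg_mono {N : ℕ} {f g : SpinConfig N → ℝ} (h : ∀ σ, f σ ≤ g σ) :
    spinAvg N f ≤ spinAvg N g := by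
  unfold spinAvg; gcongr with σ; exact h σ

lemma spinAvg_const (N : ℕ) (c : ℝ) : spinAvg N (fun _ => c) = c := by
  simp [spinAvg]

lemma spinAvg_add (N : ℕ) (f g : SpinConfig N → ℝ) :
    spinAvg N (fun σ => f σ + g σ) = spinAvg N f + spinAvg N g := by
  simp [spinAvg, Finset.sum_add_distrib, add_div]

lemma spinAvg_sub (N : ℕ) (f g : SpinConfig N → ℝ) :
    spinAvg N (fun σ => f σ - g σ) = spinAvg N f - spinAvg N g := by
  simp [spinAvg, Finset.sum_sub_distrib, sub_div]

lemma spinAvg_const_mul (N : ℕ) (c : ℝ) (f : SpinConfig N → ℝ) :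
    spinAvg N (fun σ => c * f σ) = c * spinAvg N f := by
  simp_rw [spinAvg, ← Finset.mul_sum, mul_div_assoc]

lemma spinAvg_mul_spinAvg (N : ℕ) (f g : SpinConfig N → ℝ) :
    spinAvg N (fun σ => spinAvg N fun τ => f σ * g τ) = spinAvg N f * spinAvg N g := by
  simp_rw [spinAvg_const_mul, mul_comm _ (spinAvg N g), spinAvg_const_mul]

lemma spinAvg_mul_right {N : ℕ} (f : SpinConfig N → ℝ) (σ : SpinConfig N) :
    spinAvg N (fun τ => f (σ * τ)) = spinAvg N f := by
  unfold spinAvg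
  congr 1
  exact Equiv.sum_comp (Equiv.mulLeft σ) f

lemma abs_spinAvg_le {N : ℕ} (f : SpinConfig N → ℝ) :
    |spinAvg N f| ≤ spinAvg N fun σ => |f σ| := by
  unfold spinAvg
  rw [abs_div, abs_of_pos (by positivity : (0 : ℝ) < 2 ^ N)]
  gcongr
  exact Finset.abs_sum_le_sum_abs _ _

/-- The rescaled magnetization `|σ| / √N`. -/
noncomputable def rescaledMag {N : ℕ} (σ : SpinConfig N) : ℝ := magnetization σ / √(N : ℝ)

lemma sum_exp_mul_magnetization (N : ℕ) (a : ℝ) :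
    ∑ σ : SpinConfig N, Real.exp (a * magnetization σ) = (2 * Real.cosh a) ^ N := by
  have := sum_prod_units N fun s : ℤˣ => Real.exp (a * ((s : ℤ) : ℝ))
  simp_rw [magnetization, Finset.mul_sum, Real.exp_sum, spin]
  rw [this, Real.cosh_eq]
  congr 1
  simp
  ring

lemma integrable_exp_mul_sq_gaussianReal {c : ℝ} (hc : c < 1 / 2) :
    Integrable (fun z => Real.exp (c * z ^ 2)) (gaussianReal 0 1) := by
  rw [gaussianReal_of_var_ne_zero _ one_ne_zero,
    integrable_withDensity_iff (measurable_gaussianPDF _ _)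
      (ae_of_all _ fun _ => ENNReal.ofReal_lt_top)]
  simp_rw [toReal_gaussianPDF, gaussianPDFReal]
  have := (integrable_exp_neg_mul_sq (sub_pos.2 hc)).mul_const (√(2 * Real.pi))⁻¹
  refine this.congr (ae_of_all _ fun z => ?_)
  simp only [NNReal.coe_one, mul_one, sub_zero]
  rw [mul_left_comm, ← Real.exp_add, mul_comm]
  congr 2
  ring

/-- Hubbard–Stratonovich: exp(c x²) is the mean of exp(√(2c) x z) over a standard Gaussian z. The
spin average then becomes a power of cosh, and cosh a ≤ exp(a²/2) removes N. -/
lemma spinAvg_exp_mul_sq_le {c : ℝ} (h0 : 0 ≤ c) (hc : c < 1 / 2) (N : ℕ) :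
    spinAvg N (fun σ => Real.exp (c * rescaledMag σ ^ 2))
      ≤ ∫ z, Real.exp (c * z ^ 2) ∂gaussianReal 0 1 := by
  have hmgf (x : ℝ) : Real.exp (c * x ^ 2)
      = ∫ z, Real.exp (√(2 * c) * x * z) ∂gaussianReal 0 1 := by
    have := congrFun (mgf_fun_id_gaussianReal (μ := 0) (v := 1)) (√(2 * c) * x)
    rw [mgf] at this
    rw [this, mul_pow, Real.sq_sqrt (by positivity)]
    congr 1
    simp
    ring
  unfold spinAvg
  rw [div_le_iff₀ (by positivity), ← integral_mul_const,
    Finset.sum_congr rfl fun σ _ => hmgf (rescaledMag σ)]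
  rw [← integral_finsetSum _ fun σ _ => integrable_exp_mul_gaussianReal _]
  refine integral_mono (integrable_finsetSum _ fun σ _ => integrable_exp_mul_gaussianReal _)
    ((integrable_exp_mul_sq_gaussianReal hc).mul_const _) fun z => ?_
  have h (σ : SpinConfig N) : √(2 * c) * rescaledMag σ * z
      = √(2 * c) * z / √N * magnetization σ := by
    unfold rescaledMag; ring
  simp_rw [h]
  rw [sum_exp_mul_magnetization, mul_pow, mul_comm]
  gcongr
  calc Real.cosh (√(2 * c) * z / √N) ^ N
      ≤ Real.exp ((√(2 * c) * z / √N) ^ 2 / 2) ^ N := by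
        gcongr
        exact Real.cosh_le_exp_half_sq _
    _ ≤ Real.exp (c * z ^ 2) := by
        rw [← Real.exp_nat_mul, Real.exp_le_exp, div_pow, mul_pow, Real.sq_sqrt (by positivity), Real.sq_sqrt (by positivity)]
        rcases Nat.eq_zero_or_pos N with rfl | hN
        · simp; positivity
        · have : (0 : ℝ) < N := by exact_mod_cast hN
          apply le_of_eq; field_simp

end SpinSums

/-! ### Central limit theorem for the magnetization -/

section CentralLimit

/-- The law of the rescaled magnetization under the uniform distribution. -/
noncomputable def rescaledMagLaw (N : ℕ) : Measure ℝ :=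
  ((2 : ENNReal) ^ N)⁻¹ • ∑ σ : SpinConfig N, Measure.dirac (rescaledMag σ)

instance (N : ℕ) : IsProbabilityMeasure (rescaledMagLaw N) where
  measure_univ := by
    simp [rescaledMagLaw]
    exact ENNReal.inv_mul_cancel (by simp) (by simp)

lemma integral_rescaledMagLaw {E : Type*} [NormedAddCommGroup E] [NormedSpace ℝ E]
    [CompleteSpace E] (N : ℕ) (f : ℝ → E) :
    ∫ x, f x ∂rescaledMagLaw N
      = ((2 : ℝ) ^ N)⁻¹ • ∑ σ : SpinConfig N, f (rescaledMag σ) := by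
  rw [rescaledMagLaw, integral_smul_measure,
    integral_finsetSum_measure fun σ _ => integrable_dirac (by simp)]
  simp

/-- The law of a single uniform spin. -/
noncomputable def spinLaw : Measure ℝ :=
  (2 : ENNReal)⁻¹ • (Measure.dirac 1 + Measure.dirac (-1))

instance : IsProbabilityMeasure spinLaw where
  measure_univ := by
    simp [spinLaw, ENNReal.inv_two_add_inv_two]

lemma integral_spinLaw {E : Type*} [NormedAddCommGroup E] [NormedSpace ℝ E]
    [CompleteSpace E] (f : ℝ → E) :
    ∫ x, f x ∂spinLaw = (2 : ℝ)⁻¹ • (f 1 + f (-1)) := by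
  rw [spinLaw, integral_smul_measure,
    integral_add_measure (integrable_dirac (by simp)) (integrable_dirac (by simp))]
  simp

lemma charFun_rescaledMagLaw (N : ℕ) (t : ℝ) :
    charFun (rescaledMagLaw N) t = charFun spinLaw ((√N)⁻¹ * t) ^ N := by
  rw [charFun_apply_real, charFun_apply_real, integral_rescaledMagLaw, integral_spinLaw]
  have := sum_prod_units N fun s : ℤˣ =>
    Complex.exp (((√N)⁻¹ * t : ℝ) * ((s : ℤ) : ℝ) * Complex.I)
  have h (σ : SpinConfig N) : Complex.exp (t * rescaledMag σ * Complex.I)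
      = ∏ i, Complex.exp (((√N)⁻¹ * t : ℝ) * ((σ i : ℤ) : ℝ) * Complex.I) := by
    rw [← Complex.exp_sum, ← Finset.sum_mul, ← Finset.mul_sum, rescaledMag, magnetization]
    simp only [spin]
    push_cast
    congr 2
    ring
  simp_rw [h]
  rw [this, smul_pow, inv_pow]
  simp

lemma tendsto_spinAvg_rescaledMag (g : ℝ →ᵇ ℝ) :
    Tendsto (fun N => spinAvg N fun σ => g (rescaledMag σ)) atTop
      (𝓝 (∫ x, g x ∂gaussianReal 0 1)) := by
  let μ (N : ℕ) : ProbabilityMeasure ℝ := ⟨rescaledMagLaw N, inferInstance⟩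
  let μ₀ : ProbabilityMeasure ℝ := ⟨gaussianReal 0 1, inferInstance⟩
  have h : Tendsto μ atTop (𝓝 μ₀) := by
    refine ProbabilityMeasure.tendsto_iff_tendsto_charFun.2 fun t => ?_
    have := tendsto_charFun_inv_sqrt_mul_pow (P := spinLaw) (X := id) aemeasurable_id
      (by simp [integral_spinLaw]) (by simp [integral_spinLaw]; norm_num) t
    simpa [μ, μ₀, charFun_rescaledMagLaw, charFun_gaussianReal, neg_div] using this
  have h2 := ProbabilityMeasure.tendsto_iff_forall_integral_tendsto.1 h g
  refine h2.congr fun N => ?_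
  simp [μ, integral_rescaledMagLaw, spinAvg, div_eq_inv_mul]

lemma integral_gaussianReal_pos (g : ℝ →ᵇ ℝ) (hg : ∀ x, 0 ≤ g x) (hg0 : ∃ x, g x ≠ 0) :
    0 < ∫ x, g x ∂gaussianReal 0 1 := by
  rw [integral_pos_iff_support_of_nonneg hg (g.integrable _)]
  have ho : IsOpen (Function.support g) := g.continuous.isOpen_support
  refine pos_iff_ne_zero.2 fun h => ?_
  exact (ho.measure_pos volume hg0).ne' (gaussianReal_absolutelyContinuous' 0 one_ne_zero h)

end CentralLimit

/-! ### Decoupling the two replicas -/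

section Comparison

lemma abs_exp_sub_exp_le {u v w : ℝ} (hu : u ≤ w) (hv : v ≤ w) :
    |Real.exp u - Real.exp v| ≤ |u - v| * Real.exp w := by
  wlog h : v ≤ u generalizing u v
  · rw [abs_sub_comm, abs_sub_comm u]; exact this hv hu (le_of_not_ge h)
  rw [abs_of_nonneg (sub_nonneg.2 (Real.exp_le_exp.2 h)), abs_of_nonneg (sub_nonneg.2 h)]
  have h1 : Real.exp u - Real.exp v = Real.exp u * (1 - Real.exp (v - u)) := by
    rw [mul_sub, ← Real.exp_add]; simp
  have h2 : 1 - Real.exp (v - u) ≤ u - v := by linarith [Real.add_one_le_exp (v - u)]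
  rw [h1, mul_comm]
  gcongr

/-- The exponent is at most d · max(s, t). Splitting into a sum keeps the two replicas and their
product configuration in separate terms. -/
lemma exp_add_le_exp_add_exp {c d ρ s t : ℝ} (hρ : 0 ≤ ρ) (hs : 0 ≤ s)
    (h : c + ρ ≤ d) (hc : 0 ≤ c) :
    Real.exp (ρ * t + c * s) ≤ Real.exp (d * s) + Real.exp (d * t) := by
  have h1 : ρ * t + c * s ≤ d * max s t := by
    have := le_max_left s t
    have := le_max_right s t
    nlinarith [mul_le_mul_of_nonneg_left (le_max_left s t) hc,
      mul_le_mul_of_nonneg_left (le_max_right s t) hρ]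
  refine (Real.exp_le_exp.2 h1).trans ?_
  rcases max_choice s t with h | h <;> rw [h] <;> linarith [Real.exp_pos (d * s), Real.exp_pos (d * t)]

/-- Difference of tilted weights, controlled by exponential squares. -/
lemma abs_exp_sub_exp_le_sqrt {δ κ κ' η c d s t : ℝ} (hδ : 0 ≤ δ) (hs : 0 ≤ s) (ht : 0 ≤ t)
    (hη : δ + |κ' - κ| ≤ η) (hκ : κ ≤ c) (hκ' : κ' ≤ c) (hc : 0 ≤ c)
    (hd : c + 2 * (η + √η) ≤ d) :
    |Real.exp (δ * t + κ' * s) - Real.exp (κ * s)|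
      ≤ √η * (Real.exp (d * s) + Real.exp (d * t)) := by
  have hη0 : 0 ≤ η := (add_nonneg hδ (abs_nonneg _)).trans hη
  have hδη : δ ≤ η := by linarith [abs_nonneg (κ' - κ)]
  have hκη : |κ' - κ| ≤ η := by linarith
  have h1 := abs_exp_sub_exp_le (u := δ * t + κ' * s) (v := κ * s) (w := η * t + c * s)
    (by gcongr) (by nlinarith [mul_nonneg hη0 ht, mul_le_mul_of_nonneg_right hκ hs])
  have h2 : |δ * t + κ' * s - κ * s| ≤ η * (t + s) := by
    have : δ * t + κ' * s - κ * s = δ * t + (κ' - κ) * s := by ring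
    rw [this, mul_add]
    refine (abs_add_le _ _).trans ?_
    rw [abs_mul, abs_mul, abs_of_nonneg hδ, abs_of_nonneg hs, abs_of_nonneg ht]
    gcongr
  -- Half of the small factor is kept outside as √η; the other half absorbs t + s into an
  -- exponential of small rate.
  have h3 : η * (t + s) ≤ √η * Real.exp (√η * (t + s)) := by
    have := Real.add_one_le_exp (√η * (t + s))
    calc η * (t + s) = √η * (√η * (t + s)) := by rw [← mul_assoc, Real.mul_self_sqrt hη0]
      _ ≤ _ := by gcongr; linarith
  calc _ ≤ √η * Real.exp (√η * (t + s)) * Real.exp (η * t + c * s) :=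
        h1.trans (by gcongr; exact h2.trans h3)
    _ = √η * Real.exp ((η + √η) * t + (c + √η) * s) := by
        rw [mul_assoc, ← Real.exp_add]; congr 2; ring
    _ ≤ _ := by
        gcongr
        have := Real.sqrt_nonneg η
        exact exp_add_le_exp_add_exp (by positivity) hs (by linarith) (by positivity)

/-- For fixed σ, the configuration `σ * τ` is again uniform, so its term needs only the one-replica
bound; the other term is a product. -/
lemma rescaledMag_mul_avg_le {d : ℝ} (hd : 0 ≤ d) (hd' : d < 1 / 2) (N : ℕ) :
    spinAvg N (fun σ => spinAvg N fun τ =>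
      Real.exp (d * (rescaledMag σ ^ 2 + rescaledMag τ ^ 2))
        + Real.exp (d * rescaledMag (σ * τ) ^ 2))
      ≤ (∫ z, Real.exp (d * z ^ 2) ∂gaussianReal 0 1) ^ 2
        + ∫ z, Real.exp (d * z ^ 2) ∂gaussianReal 0 1 := by
  have h := spinAvg_exp_mul_sq_le hd hd' N
  have h0 : 0 ≤ spinAvg N fun σ => Real.exp (d * rescaledMag σ ^ 2) := by
    unfold spinAvg; positivity
  simp_rw [spinAvg_add, mul_add, Real.exp_add]
  rw [spinAvg_mul_spinAvg]
  have h2 (σ : SpinConfig N) := spinAvg_mul_right (fun τ => Real.exp (d * rescaledMag τ ^ 2)) σ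
  simp_rw [h2, spinAvg_const]
  nlinarith

lemma tendsto_spinAvg_tilt_sub (g : ℝ →ᵇ ℝ) {δ κ κ' : ℕ → ℝ} {κ₀ : ℝ} (hκ₀ : 0 < κ₀)
    (hκ₀' : κ₀ < 1 / 2) (hδ0 : ∀ᶠ N in atTop, 0 ≤ δ N) (hδ : Tendsto δ atTop (𝓝 0))
    (hκ : Tendsto κ atTop (𝓝 κ₀)) (hκ' : Tendsto κ' atTop (𝓝 κ₀)) :
    Tendsto (fun N => spinAvg N (fun σ => spinAvg N fun τ =>
        Real.exp (δ N * rescaledMag (σ * τ) ^ 2 + κ' N * (rescaledMag σ ^ 2 + rescaledMag τ ^ 2))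
          * (g (rescaledMag σ) * g (rescaledMag τ)))
      - (spinAvg N fun σ => Real.exp (κ N * rescaledMag σ ^ 2) * g (rescaledMag σ)) ^ 2)
      atTop (𝓝 0) := by
  -- The level c eventually dominates both tilts; the gap from c to d < 1/2 absorbs the perturbation
  -- while keeping Gaussian integrability.
  obtain ⟨c, hc, hc'⟩ := exists_between hκ₀'
  obtain ⟨d, hd, hd'⟩ := exists_between hc'
  have hc0 : 0 < c := hκ₀.trans hc
  have hd0 : 0 < d := hc0.trans hd
  set η : ℕ → ℝ := fun N => δ N + |κ' N - κ N| with hηdef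
  have hη : Tendsto η atTop (𝓝 0) := by
    simpa using hδ.add (hκ'.sub hκ).abs
  have hsη : Tendsto (fun N => √(η N)) atTop (𝓝 0) := by
    simpa [Function.comp_def] using (Real.continuous_sqrt.tendsto 0).comp hη
  set C := ∫ z, Real.exp (d * z ^ 2) ∂gaussianReal 0 1
  have hlim : Tendsto (fun N => ‖g‖ ^ 2 * √(η N) * (C ^ 2 + C)) atTop (𝓝 0) := by
    simpa using (hsη.const_mul (‖g‖ ^ 2)).mul_const (C ^ 2 + C)
  have hρ : ∀ᶠ N in atTop, c + 2 * (η N + √(η N)) ≤ d := by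
    have : Tendsto (fun N => c + 2 * (η N + √(η N))) atTop (𝓝 c) := by
      simpa using ((hη.add hsη).const_mul 2).const_add c
    exact this.eventually_le_const hd
  refine squeeze_zero_norm' ?_ hlim
  filter_upwards [hδ0, hρ, hκ.eventually_le_const hc, hκ'.eventually_le_const hc]
    with N h1 h2 h3 h4
  rw [sq, ← spinAvg_mul_spinAvg, ← spinAvg_sub]
  simp_rw [← spinAvg_sub]
  rw [Real.norm_eq_abs]
  calc _ ≤ spinAvg N fun σ => spinAvg N fun τ => ‖g‖ ^ 2 * √(η N) *
        (Real.exp (d * (rescaledMag σ ^ 2 + rescaledMag τ ^ 2))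
        + Real.exp (d * rescaledMag (σ * τ) ^ 2)) := by
        refine (abs_spinAvg_le _).trans (spinAvg_mono fun σ => ?_)
        refine (abs_spinAvg_le _).trans (spinAvg_mono fun τ => ?_)
        have e : ∀ x y a b : ℝ, Real.exp (κ N * x) * a * (Real.exp (κ N * y) * b)
            = Real.exp (κ N * (x + y)) * (a * b) := by
          intro x y a b; rw [mul_add, Real.exp_add]; ring
        rw [e, ← sub_mul, abs_mul, abs_mul]
        have b1 := abs_exp_sub_exp_le_sqrt h1
          (add_nonneg (sq_nonneg (rescaledMag σ)) (sq_nonneg (rescaledMag τ)))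
          (sq_nonneg (rescaledMag (σ * τ))) (le_refl (η N)) h3 h4 hc0.le h2
        have b2 := g.norm_coe_le_norm (rescaledMag σ)
        have b3 := g.norm_coe_le_norm (rescaledMag τ)
        rw [Real.norm_eq_abs] at b2 b3
        calc _ ≤ (√(η N) * (Real.exp (d * (rescaledMag σ ^ 2 + rescaledMag τ ^ 2))
              + Real.exp (d * rescaledMag (σ * τ) ^ 2))) * (‖g‖ * ‖g‖) := by gcongr
          _ = _ := by ring
    _ ≤ _ := by
        simp_rw [spinAvg_const_mul]
        gcongr
        exact rescaledMag_mul_avg_le hd0.le hd' N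

end Comparison

/-! ### Moments of the partition function -/

section PartitionFunction

lemma natCast_mul_rescaledMag_sq {N : ℕ} (σ : SpinConfig N) :
    (N : ℝ) * rescaledMag σ ^ 2 = magnetization σ ^ 2 := by
  rcases Nat.eq_zero_or_pos N with rfl | hN
  · simp [magnetization]
  · have : (0 : ℝ) < N := by exact_mod_cast hN
    rw [rescaledMag, div_pow, Real.sq_sqrt this.le]
    field_simp

/-- There are finitely many digraphs on `Fin N`, which makes every measurable graph observable
bounded. -/
lemma exists_bound_digraph {N : ℕ} (f : Digraph (Fin N) → ℝ) : ∃ C, ∀ G, ‖f G‖ ≤ C := by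
  have : Finite (Digraph (Fin N)) :=
    Finite.of_injective (fun G => G.Adj) fun G H h => Digraph.ext h
  obtain ⟨C, hC⟩ := (Set.finite_range fun G => ‖f G‖).bddAbove
  exact ⟨C, fun G => hC ⟨G, rfl⟩⟩

variable {Ω : Type*} [MeasurableSpace Ω] {P : Measure Ω} {N : ℕ} {q : ℝ}
  {G : Ω → Digraph (Fin N)}

lemma IsDirectedErdosRenyi.measurable_exp_hamiltonian (hG : IsDirectedErdosRenyi P q G) (β : ℝ)
    (σ : SpinConfig N) : Measurable fun ω => Real.exp (-β * hamiltonian q (G ω) σ) := by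
  have := hG.measurable_edgeIndicator
  simp_rw [neg_mul_hamiltonian]
  fun_prop

lemma IsDirectedErdosRenyi.measurable_partitionFunction (hG : IsDirectedErdosRenyi P q G)
    (β : ℝ) (g : ℝ → ℝ) : Measurable fun ω => partitionFunction q (G ω) β g := by
  have := hG.measurable_exp_hamiltonian β
  unfold partitionFunction
  fun_prop

variable [IsProbabilityMeasure P]

lemma memLp_comp_digraph (f : Digraph (Fin N) → ℝ) (hf : Measurable fun ω => f (G ω))
    (r : ENNReal) : MemLp (fun ω => f (G ω)) r P := by
  obtain ⟨C, hC⟩ := exists_bound_digraph f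
  exact MemLp.of_bound hf.aestronglyMeasurable C (ae_of_all _ fun ω => hC _)

lemma IsDirectedErdosRenyi.memLp_partitionFunction (hG : IsDirectedErdosRenyi P q G)
    (β : ℝ) (g : ℝ → ℝ) (r : ENNReal) : MemLp (fun ω => partitionFunction q (G ω) β g) r P :=
  memLp_comp_digraph (fun G => partitionFunction q G β g) (hG.measurable_partitionFunction β g) r

lemma IsDirectedErdosRenyi.integral_partitionFunction (hG : IsDirectedErdosRenyi P q G)
    (h0 : 0 < q) (h1 : q ≤ 1) (β : ℝ) (g : ℝ → ℝ) :
    ∫ ω, partitionFunction q (G ω) β g ∂P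
      = 2 ^ N * Real.exp (N ^ 2 * cgfEven q (β / (2 * N * q)))
        * spinAvg N fun σ =>
            Real.exp (N * cgfOdd q (β / (2 * N * q)) * rescaledMag σ ^ 2) * g (rescaledMag σ) := by
  have hint (σ : SpinConfig N) : Integrable (fun ω => Real.exp (-β * hamiltonian q (G ω) σ)
      * g (magnetization σ / √N)) P :=
    ((memLp_comp_digraph (fun G => Real.exp (-β * hamiltonian q G σ))
      (hG.measurable_exp_hamiltonian β σ) 1).integrable le_rfl).mul_const _
  unfold partitionFunction
  rw [integral_finsetSum _ fun σ _ => hint σ]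
  simp_rw [integral_mul_const, hG.integral_exp_hamiltonian h0 h1, Real.exp_add,
    ← natCast_mul_rescaledMag_sq, mul_assoc, ← Finset.mul_sum, spinAvg, mul_left_comm (N : ℝ)]
  field_simp
  rfl

lemma IsDirectedErdosRenyi.integral_partitionFunction_sq (hG : IsDirectedErdosRenyi P q G)
    (h0 : 0 < q) (h1 : q ≤ 1) (β : ℝ) (g : ℝ → ℝ) :
    ∫ ω, partitionFunction q (G ω) β g ^ 2 ∂P
      = (2 ^ N) ^ 2 * Real.exp (N ^ 2 * (cgfEven q (2 * (β / (2 * N * q))) / 2))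
        * spinAvg N fun σ => spinAvg N fun τ =>
            Real.exp (N * (cgfEven q (2 * (β / (2 * N * q))) / 2) * rescaledMag (σ * τ) ^ 2
              + N * (cgfOdd q (2 * (β / (2 * N * q))) / 2)
                * (rescaledMag σ ^ 2 + rescaledMag τ ^ 2))
              * (g (rescaledMag σ) * g (rescaledMag τ)) := by
  have hmeas := hG.measurable_exp_hamiltonian β
  have hint (σ τ : SpinConfig N) : Integrable (fun ω => Real.exp (-β * hamiltonian q (G ω) σ)
      * Real.exp (-β * hamiltonian q (G ω) τ)
      * (g (magnetization σ / √N) * g (magnetization τ / √N))) P :=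
    ((memLp_comp_digraph (fun G => Real.exp (-β * hamiltonian q G σ)
        * Real.exp (-β * hamiltonian q G τ))
      ((hmeas σ).mul (hmeas τ)) 1).integrable le_rfl).mul_const _
  unfold partitionFunction
  simp_rw [sq (Finset.sum _ _), Finset.sum_mul_sum, mul_mul_mul_comm]
  rw [integral_finsetSum _ fun σ _ => integrable_finsetSum _ fun τ _ => hint σ τ]
  simp_rw [integral_finsetSum _ fun τ _ => hint _ τ, integral_mul_const,
    hG.integral_exp_hamiltonian_mul h0 h1, add_assoc, Real.exp_add _ (_ + _),
    ← natCast_mul_rescaledMag_sq, mul_assoc, ← Finset.mul_sum, spinAvg, ← Finset.sum_div]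
  field_simp
  rfl

end PartitionFunction

/-! ### Asymptotics of the coefficients -/

section Limits

variable {p : ℕ → ℝ}

lemma tendsto_natCast_mul_atTop (hp : ∀ N : ℕ, 1 ≤ N → 0 < p N ∧ p N ≤ 1)
    (hlim : Tendsto (fun N : ℕ => p N ^ 3 * (N : ℝ) ^ 2) atTop atTop) :
    Tendsto (fun N : ℕ => (N : ℝ) * p N) atTop atTop := by
  have h : Tendsto (fun N : ℕ => ((N : ℝ) * p N) ^ 2) atTop atTop := by
    refine tendsto_atTop_mono' _ ?_ hlim
    filter_upwards [eventually_ge_atTop 1] with N hN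
    obtain ⟨h0, h1⟩ := hp N hN
    -- As p ≤ 1, the hypothesis on p³N² forces (Np)² → ∞.
    have : p N ^ 3 ≤ p N ^ 2 := pow_le_pow_of_le_one h0.le h1 (by norm_num)
    rw [mul_pow, mul_comm]
    gcongr
  refine (Real.tendsto_sqrt_atTop.comp h).congr' ?_
  filter_upwards [eventually_ge_atTop 1] with N hN
  exact Real.sqrt_sq (mul_nonneg N.cast_nonneg (hp N hN).1.le)

variable (hp : ∀ N : ℕ, 1 ≤ N → 0 < p N ∧ p N ≤ 1)
  (hlim : Tendsto (fun N : ℕ => p N ^ 3 * (N : ℝ) ^ 2) atTop atTop)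

include hp hlim

lemma tendsto_coupling (β : ℝ) : Tendsto (fun N : ℕ => β / (2 * N * p N)) atTop (𝓝 0) := by
  have := (tendsto_natCast_mul_atTop hp hlim).const_mul_atTop two_pos
  simp_rw [← mul_assoc] at this
  exact this.const_div_atTop β

lemma tendsto_natCast_mul_coupling_sq (β : ℝ) :
    Tendsto (fun N : ℕ => N * (p N * (β / (2 * N * p N)) ^ 2)) atTop (𝓝 0) := by
  have h := (tendsto_coupling hp hlim β).const_mul (β / 2)
  rw [mul_zero] at h
  refine h.congr' ?_
  filter_upwards [eventually_ge_atTop 1] with N hN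
  have h1 : (0 : ℝ) < N := by exact_mod_cast hN
  have h2 := (hp N hN).1
  field_simp

lemma eventually_abs_coupling_le (β : ℝ) {r : ℝ} (hr : 0 < r) :
    ∀ᶠ N : ℕ in atTop, |β / (2 * N * p N)| ≤ r := by
  have := (tendsto_coupling hp hlim β).abs
  rw [abs_zero] at this
  exact this.eventually_le_const hr

/-- The linear part is N p γ = β/2 exactly, and the error is O(Npγ²). The cases k = 1 and k = 2
serve the first and second moments. -/
lemma tendsto_natCast_mul_cgfOdd (β : ℝ) (k : ℝ) (hk : k ≠ 0) :
    Tendsto (fun N : ℕ => N * (cgfOdd (p N) (k * (β / (2 * N * p N))) / k)) atTop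
      (𝓝 (β / 2)) := by
  rw [tendsto_iff_norm_sub_tendsto_zero]
  have h := (tendsto_natCast_mul_coupling_sq hp hlim β).const_mul (9 * |k|)
  rw [mul_zero] at h
  refine squeeze_zero' (Eventually.of_forall fun _ => norm_nonneg _) ?_ h
  have hk' := abs_pos.2 hk
  filter_upwards [eventually_ge_atTop 1, eventually_abs_coupling_le hp hlim β
    (show 0 < 1 / 4 / |k| by positivity)] with N hN hγ
  have h1 : (0 : ℝ) < N := by exact_mod_cast hN
  obtain ⟨h2, h3⟩ := hp N hN
  have hβ : β / 2 = N * (p N * (k * (β / (2 * N * p N))) / k) := by field_simp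
  set γ := β / (2 * N * p N)
  have h4 := abs_cgfOdd_sub_le h2 h3 (x := k * γ)
    (by rw [abs_mul, mul_comm]; exact (le_div_iff₀ hk').1 hγ)
  rw [hβ, ← mul_sub, ← sub_div, norm_mul, norm_div, Real.norm_eq_abs, Real.norm_eq_abs,
    Real.norm_eq_abs, abs_of_pos h1]
  calc N * (|cgfOdd (p N) (k * γ) - p N * (k * γ)| / |k|)
      ≤ N * (9 * p N * (k * γ) ^ 2 / |k|) := by gcongr
    _ = _ := by
      rw [mul_pow, ← sq_abs k]
      field_simp

lemma tendsto_natCast_mul_cgfEven (β : ℝ) :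
    Tendsto (fun N : ℕ => N * (cgfEven (p N) (2 * (β / (2 * N * p N))) / 2)) atTop (𝓝 0) := by
  have h := (tendsto_natCast_mul_coupling_sq hp hlim β).const_mul 3
  rw [mul_zero] at h
  refine squeeze_zero' ?_ ?_ h
  · filter_upwards [eventually_ge_atTop 1] with N hN
    have := cgfEven_nonneg (hp N hN).1 (hp N hN).2 (2 * (β / (2 * N * p N)))
    positivity
  · filter_upwards [eventually_ge_atTop 1, eventually_abs_coupling_le hp hlim β one_pos]
      with N hN hγ
    calc _ ≤ (N : ℝ) * (3 * p N * (β / (2 * N * p N)) ^ 2) := by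
          gcongr; exact cgfEven_two_mul_le_sq (hp N hN).1 (hp N hN).2 hγ
      _ = _ := by ring

lemma tendsto_sq_mul_coupling_pow_four (β : ℝ) :
    Tendsto (fun N : ℕ => (N : ℝ) ^ 2 * (8 * p N * (β / (2 * N * p N)) ^ 4)) atTop (𝓝 0) := by
  have h := hlim.const_div_atTop (β ^ 4 / 2)
  refine h.congr' ?_
  filter_upwards [eventually_ge_atTop 1] with N hN
  have h1 : (0 : ℝ) < N := by exact_mod_cast hN
  have h2 := (hp N hN).1
  field_simp
  norm_num

end Limits

/-! ### Normalised variance and the main theorem -/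

section SecondMoment

lemma integral_div_integral_sub_one_sq {Ω : Type*} [MeasurableSpace Ω] {P : Measure Ω}
    [IsProbabilityMeasure P] {X : Ω → ℝ} (hX : MemLp X 2 P) (hpos : 0 < ∫ ω, X ω ∂P) :
    ∫ ω, (X ω / (∫ ω', X ω' ∂P) - 1) ^ 2 ∂P
      = (∫ ω, X ω ^ 2 ∂P) / (∫ ω, X ω ∂P) ^ 2 - 1 := by
  set m := ∫ ω, X ω ∂P with hm
  have h (ω : Ω) : (X ω / m - 1) ^ 2 = X ω ^ 2 / m ^ 2 - 2 / m * X ω + 1 := by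
    field_simp; ring
  have hi := hX.integrable one_le_two
  simp_rw [h]
  rw [integral_add (f := fun ω => X ω ^ 2 / m ^ 2 - 2 / m * X ω)
      ((hX.integrable_sq.div_const _).sub (hi.const_mul _)) (integrable_const _),
    integral_sub (hX.integrable_sq.div_const _) (hi.const_mul _), integral_div,
    integral_const_mul, ← hm]
  simp
  field_simp
  ring

lemma eLpNorm_two_eq_ofReal_sqrt {Ω : Type*} [MeasurableSpace Ω] {P : Measure Ω} {X : Ω → ℝ}
    (hX : MemLp X 2 P) : eLpNorm X 2 P = ENNReal.ofReal √(∫ ω, X ω ^ 2 ∂P) := by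
  rw [hX.eLpNorm_eq_integral_rpow_norm two_ne_zero ENNReal.ofNat_ne_top, Real.sqrt_eq_rpow]
  simp

end SecondMoment

end DiluteIsing

open DiluteIsing in
theorem theorem1p2 (β : ℝ) (hβ0 : 0 < β) (hβ1 : β < 1)
    (p : ℕ → ℝ) (hp : ∀ N : ℕ, 1 ≤ N → 0 < p N ∧ p N ≤ 1)
    (hlim : Tendsto (fun N : ℕ => p N ^ 3 * (N : ℝ) ^ 2) atTop atTop)
    {Ω : ℕ → Type*} [∀ N, MeasurableSpace (Ω N)]
    (P : ∀ N, Measure (Ω N)) [∀ N, IsProbabilityMeasure (P N)]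
    (G : ∀ N, Ω N → Digraph (Fin N))
    (hG : ∀ N : ℕ, 1 ≤ N → DiluteIsing.IsDirectedErdosRenyi (P N) (p N) (G N))
    (g : ℝ →ᵇ ℝ) (hg : ∀ x, 0 ≤ g x) (hg0 : ∃ x, g x ≠ 0)
    (Z : ∀ N, Ω N → ℝ)
    (hZ : ∀ N ω, Z N ω = DiluteIsing.partitionFunction (p N) (G N ω) β g) :
    -- `Z_N` is square integrable, and the quotient `Z_N / E Z_N` is eventually well defined
    (∀ N : ℕ, 1 ≤ N → MemLp (Z N) 2 (P N)) ∧
    (∀ᶠ N in atTop, 0 < ∫ ω, Z N ω ∂(P N)) ∧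
    -- convergence in `L²`
    Tendsto (fun N => eLpNorm (fun ω => Z N ω / (∫ ω', Z N ω' ∂(P N)) - 1) 2 (P N))
      atTop (𝓝 0) ∧
    -- convergence in probability
    (∀ δ : ℝ, 0 < δ →
      Tendsto (fun N => P N {ω | δ ≤ |Z N ω / (∫ ω', Z N ω' ∂(P N)) - 1|}) atTop (𝓝 0)) := by
  have hZ' (N : ℕ) : Z N = fun ω => partitionFunction (p N) (G N ω) β g := funext (hZ N)
  have hmem (N : ℕ) (hN : 1 ≤ N) : MemLp (Z N) 2 (P N) := by
    rw [hZ']; exact (hG N hN).memLp_partitionFunction β g 2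
  -- the tilted averages entering the first and second moments
  set γ : ℕ → ℝ := fun N => β / (2 * N * p N) with hγ
  set D : ℕ → ℝ := fun N => spinAvg N fun σ =>
    Real.exp (N * cgfOdd (p N) (γ N) * rescaledMag σ ^ 2) * g (rescaledMag σ) with hD
  set E : ℕ → ℝ := fun N => spinAvg N fun σ => spinAvg N fun τ =>
    Real.exp (N * (cgfEven (p N) (2 * γ N) / 2) * rescaledMag (σ * τ) ^ 2
      + N * (cgfOdd (p N) (2 * γ N) / 2) * (rescaledMag σ ^ 2 + rescaledMag τ ^ 2))
      * (g (rescaledMag σ) * g (rescaledMag τ)) with hE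
  have hfirst (N : ℕ) (hN : 1 ≤ N) :
      ∫ ω, Z N ω ∂(P N) = 2 ^ N * Real.exp (N ^ 2 * cgfEven (p N) (γ N)) * D N := by
    rw [hZ']; exact (hG N hN).integral_partitionFunction (hp N hN).1 (hp N hN).2 β g
  have hsecond (N : ℕ) (hN : 1 ≤ N) : ∫ ω, Z N ω ^ 2 ∂(P N)
      = (2 ^ N) ^ 2 * Real.exp (N ^ 2 * (cgfEven (p N) (2 * γ N) / 2)) * E N := by
    rw [hZ']; exact (hG N hN).integral_partitionFunction_sq (hp N hN).1 (hp N hN).2 β g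
  obtain ⟨c, hc0, hc⟩ := exists_between (integral_gaussianReal_pos g hg hg0)
  -- The tilt is at least 1 because its exponent is nonnegative, so the untilted average, controlled
  -- by the central limit theorem, bounds D from below.
  have hDc : ∀ᶠ N in atTop, c ≤ D N := by
    filter_upwards [eventually_ge_atTop 1,
      (tendsto_spinAvg_rescaledMag g).eventually_const_le hc] with N hN h
    refine h.trans (spinAvg_mono fun σ => le_mul_of_one_le_left (hg _) (Real.one_le_exp ?_))
    have h0 := (hp N hN).1
    have := cgfOdd_nonneg h0 (hp N hN).2 (x := γ N) (by simp only [hγ]; positivity)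
    positivity
  have hpos : ∀ᶠ N in atTop, 0 < ∫ ω, Z N ω ∂(P N) := by
    filter_upwards [eventually_ge_atTop 1, hDc] with N hN h
    rw [hfirst N hN]
    have : 0 < D N := hc0.trans_le h
    positivity
  have hdiff : Tendsto (fun N => E N - D N ^ 2) atTop (𝓝 0) := by
    refine tendsto_spinAvg_tilt_sub g (κ₀ := β / 2) (by positivity) (by linarith)
      (δ := fun N => N * (cgfEven (p N) (2 * γ N) / 2))
      (κ' := fun N => N * (cgfOdd (p N) (2 * γ N) / 2)) ?_
      (tendsto_natCast_mul_cgfEven hp hlim β) ?_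
      (tendsto_natCast_mul_cgfOdd hp hlim β 2 two_ne_zero)
    · filter_upwards [eventually_ge_atTop 1] with N hN
      have := cgfEven_nonneg (hp N hN).1 (hp N hN).2 (2 * γ N)
      positivity
    · simpa using tendsto_natCast_mul_cgfOdd hp hlim β 1 one_ne_zero
  have hvar : Tendsto (fun N => ∫ ω, (Z N ω / (∫ ω', Z N ω' ∂(P N)) - 1) ^ 2 ∂(P N))
      atTop (𝓝 0) := by
    have hup : Tendsto (fun N : ℕ => Real.exp ((N : ℝ) ^ 2 * (8 * p N * γ N ^ 4))
        * (1 + |E N - D N ^ 2| / c ^ 2) - 1) atTop (𝓝 0) := by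
      have h1 := (Real.continuous_exp.tendsto 0).comp (tendsto_sq_mul_coupling_pow_four hp hlim β)
      have h2 := (hdiff.abs.div_const (c ^ 2)).const_add 1
      simpa using (h1.mul h2).sub_const 1
    -- The variance is nonnegative, so only an upper bound on the second-moment ratio is needed.
    refine squeeze_zero' (Eventually.of_forall fun N => integral_nonneg fun ω => sq_nonneg _)
      ?_ hup
    filter_upwards [eventually_ge_atTop 1, hDc, hpos,
      eventually_abs_coupling_le hp hlim β one_pos] with N hN hDN hposN hγN
    rw [integral_div_integral_sub_one_sq (hmem N hN) hposN, hfirst N hN, hsecond N hN]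
    have hDpos : 0 < D N := hc0.trans_le hDN
    have hexp := cgfEven_two_mul_sub_le (hp N hN).1 (hp N hN).2 hγN
    have hquot : (2 ^ N) ^ 2 * Real.exp (N ^ 2 * (cgfEven (p N) (2 * γ N) / 2)) * E N
        / (2 ^ N * Real.exp (N ^ 2 * cgfEven (p N) (γ N)) * D N) ^ 2
        = Real.exp (N ^ 2 * (cgfEven (p N) (2 * γ N) / 2 - 2 * cgfEven (p N) (γ N)))
          * (1 + (E N - D N ^ 2) / D N ^ 2) := by
      rw [mul_sub, Real.exp_sub, show (N : ℝ) ^ 2 * (2 * cgfEven (p N) (γ N))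
        = (2 : ℕ) * (N ^ 2 * cgfEven (p N) (γ N)) by push_cast; ring, Real.exp_nat_mul]
      field_simp
      ring
    rw [hquot]
    refine sub_le_sub_right ((mul_le_mul_of_nonneg_left (b := _)
      (c := 1 + |E N - D N ^ 2| / c ^ 2) ?_ (Real.exp_pos _).le).trans ?_) 1
    · gcongr
      exact le_abs_self _
    · gcongr
  have hmem' (N : ℕ) (hN : 1 ≤ N) :
      MemLp (fun ω => Z N ω / (∫ ω', Z N ω' ∂(P N)) - 1) 2 (P N) := by
    simp_rw [div_eq_inv_mul]
    exact ((hmem N hN).const_mul _).sub (memLp_const 1)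
  have hL2 : Tendsto (fun N => eLpNorm (fun ω => Z N ω / (∫ ω', Z N ω' ∂(P N)) - 1) 2 (P N))
      atTop (𝓝 0) := by
    have h1 := (ENNReal.continuous_ofReal.comp Real.continuous_sqrt).tendsto 0 |>.comp hvar
    simp only [Function.comp_def, Real.sqrt_zero, ENNReal.ofReal_zero] at h1
    refine h1.congr' ?_
    filter_upwards [eventually_ge_atTop 1] with N hN
    exact (eLpNorm_two_eq_ofReal_sqrt (hmem' N hN)).symm
  refine ⟨hmem, hpos, hL2, fun δ hδ => ?_⟩
  have hδ' : ENNReal.ofReal δ ≠ 0 := by simpa using hδ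
  have hlim0 : Tendsto (fun N => (ENNReal.ofReal δ)⁻¹ ^ (2 : ENNReal).toReal
      * eLpNorm (fun ω => Z N ω / (∫ ω', Z N ω' ∂(P N)) - 1) 2 (P N) ^ (2 : ENNReal).toReal)
      atTop (𝓝 0) := by
    have h1 := (ENNReal.continuous_rpow_const (y := (2 : ENNReal).toReal)).tendsto 0 |>.comp hL2
    rw [ENNReal.zero_rpow_of_pos (by simp)] at h1
    have h2 := ENNReal.Tendsto.const_mul h1 (a := (ENNReal.ofReal δ)⁻¹ ^ (2 : ENNReal).toReal)
      (Or.inr (ENNReal.rpow_ne_top_of_nonneg (by simp) (ENNReal.inv_ne_top.2 hδ')))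
    rwa [mul_zero] at h2
  refine tendsto_of_tendsto_of_tendsto_of_le_of_le' tendsto_const_nhds hlim0
    (Eventually.of_forall fun _ => zero_le) ?_
  -- Chebyshev's inequality with exponent 2.
  filter_upwards [eventually_ge_atTop 1] with N hN
  refine le_trans (measure_mono fun ω hω => ?_) (meas_ge_le_mul_pow_eLpNorm_enorm (P N) two_ne_zero
    ENNReal.ofNat_ne_top (hmem' N hN).aestronglyMeasurable hδ' fun h => absurd h ENNReal.ofReal_ne_top)
  simp only [Set.mem_ofPred_eq] at hω ⊢
  rw [Real.enorm_eq_ofReal_abs]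
  exact ENNReal.ofReal_le_ofReal hω
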